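/- Let $\mathbb X$, $\mathbb Y$ and $\mathbb U$ be Borel spaces (state, observation and action space), let $\mathcal T(dx_1\mid x_0,u_0)$ be a stochastic kernel from $\mathbb X\times\mathbb U$ to $\mathbb X$, let $Q(dy\mid x)$ be a stochastic kernel from $\mathbb X$ to $\mathbb Y$, let $c:\mathbb X\times\mathbb U\to\mathbb R$ and let $\beta\in(0,1)$. An admissible policy $\gamma=(\gamma_t)_{t\ge 0}$ is a sequence of measurable control functions with $U_t=\gamma_t(I_t)$, where $I_0=Y_0$ and $I_t=(Y_0,\dots,Y_t,U_0,\dots,U_{t-1})$ for $t\ge 1$; let $\Gamma$ be the set of admissible policies. For a prior $P$ (a probability measure on $\mathbb X$) and $\gamma\in\Gamma$, let $E_P^\gamma$ be the expectation under the law of the process $(X_t,Y_t,U_t)_{t\ge0}$ determined by $X_0\sim P$, $Y_t\sim Q(\cdot\mid X_t)$, $U_t=\gamma_t(I_t)$ and $X_{t+1}\sim\mathcal T(\cdot\mid X_t,U_t)$, and put $$J_\beta(P,\mathcal T,\gamma)=E_P^\gamma\Big[\sum_{t=0}^\infty\beta^t c(X_t,U_t)\Big],\qquad J_\beta^*(P,\mathcal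 T)=\inf_{\gamma\in\Gamma}J_\beta(P,\mathcal T,\gamma).$$ Assume that (a) $\mathcal T(\cdot\mid x,u)$ is weakly continuous in $(x,u)$; (b) $Q$ is continuous in total variation: $x_n\to x$ implies $\|Q(\cdot\mid x_n)-Q(\cdot\mid x)\|_{TV}\to0$; (c) $c$ is non-negative, bounded and continuous on $\mathbb X\times\mathbb U$; (d) $\mathbb U$ is compact. Theorem. Let $P_n\to P$ weakly, and for every $n$ let $\gamma^*_{P_n}\in\Gamma$ be optimal for the prior $P_n$, that is, $J_\beta(P_n,\mathcal T,\gamma^*_{P_n})=J_\beta^*(P_n,\mathcal T)$. Then $$J_\beta(P,\mathcal T,\gamma^*_{P_n})\to J_\beta^*(P,\mathcal T)\qquad(n\to\infty).$$ -/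

import Mathlib

open MeasureTheory ProbabilityTheory Filter Topology

noncomputable section

namespace POMDP

universe u v w

/-- The total variation distance `2 * sup_B |μ(B) - ν(B)|`, the supremum being over all measurable
sets; it is used only for probability measures, for which the supremum is over a set bounded
by `1`. -/
def tvDist {Y : Type v} [MeasurableSpace Y] (μ ν : Measure Y) : ℝ :=
  2 * ⨆ B : {B : Set Y // MeasurableSet B}, |μ.real B.1 - ν.real B.1|

/-- A stochastic kernel is weakly continuous if the integral of every bounded continuous function
depends continuously on the parameter. -/
def WeaklyContinuous {A : Type u} {B : Type v} [TopologicalSpace A] [MeasurableSpace A]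
    [TopologicalSpace B] [MeasurableSpace B] (K : Kernel A B) : Prop :=
  ∀ f : BoundedContinuousFunction B ℝ, Continuous fun a => ∫ b, f b ∂(K a)

/-- A stochastic kernel is continuous in total variation if `x_n → x` implies
`‖K(· | x_n) - K(· | x)‖_TV → 0`. -/
def TVContinuous {A : Type u} {B : Type v} [TopologicalSpace A] [MeasurableSpace A]
    [MeasurableSpace B] (K : Kernel A B) : Prop :=
  ∀ (x : A) (xs : ℕ → A), Tendsto xs atTop (𝓝 x) →
    Tendsto (fun n => tvDist (K (xs n)) (K x)) atTop (𝓝 0)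

/-- The information `I_t = (Y_0, …, Y_t, U_0, …, U_{t-1})` available at time `t`. -/
abbrev Info (Y : Type v) (U : Type w) (t : ℕ) : Type (max v w) :=
  (Fin (t + 1) → Y) × (Fin t → U)

/-- An admissible policy: a sequence of measurable control functions, `U_t = γ_t(I_t)`. -/
structure Policy (Y : Type v) (U : Type w) [MeasurableSpace Y] [MeasurableSpace U] where
  /-- The control function at time `t`. -/
  act : ∀ t : ℕ, Info Y U t → U
  measurable_act : ∀ t : ℕ, Measurable (act t)

section Model

variable {X : Type u} {Y : Type v} {U : Type w}

/-- The information at time `0` when the first observation is `y`. -/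
def info0 (U : Type w) (y : Y) : Info Y U 0 := (fun _ => y, Fin.elim0)

/-- The information at time `t + 1` when the states, observations and actions up to time `t` are
`h` and the observation at time `t + 1` is `y`. -/
def infoSucc (t : ℕ) (h : (i : Finset.Iic t) → X × Y × U) (y : Y) : Info Y U (t + 1) :=
  (Fin.snoc (α := fun _ => Y)
      (fun i : Fin (t + 1) => (h ⟨i, Finset.mem_Iic.2 (Nat.lt_succ_iff.1 i.2)⟩).2.1) y,
    fun i : Fin (t + 1) => (h ⟨i, Finset.mem_Iic.2 (Nat.lt_succ_iff.1 i.2)⟩).2.2)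

variable [MeasurableSpace X] [MeasurableSpace Y] [MeasurableSpace U]

lemma measurable_info0 : Measurable (info0 U : Y → Info Y U 0) :=
  (measurable_pi_lambda _ fun _ => measurable_id).prodMk measurable_const

lemma measurable_infoSucc (t : ℕ) :
    Measurable fun p : ((i : Finset.Iic t) → X × Y × U) × Y => infoSucc t p.1 p.2 := by
  refine Measurable.prodMk (measurable_pi_lambda _ fun i => ?_) (measurable_pi_lambda _ fun i => ?_)
  · refine Fin.lastCases ?_ (fun j => ?_) i
    · simpa using measurable_snd
    · simp only [Fin.snoc_castSucc]
      fun_prop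
  · fun_prop

/-- The triple `(x_0, y_0, u_0)` with `u_0 = γ_0(y_0)`. -/
def stage0 (γ : Policy Y U) (p : X × Y) : X × Y × U :=
  (p.1, p.2, γ.act 0 (info0 U p.2))

/-- The triple `(x_{t+1}, y_{t+1}, u_{t+1})` with `u_{t+1} = γ_{t+1}(I_{t+1})`. -/
def stageSucc (γ : Policy Y U) (t : ℕ) (p : ((i : Finset.Iic t) → X × Y × U) × (X × Y)) :
    X × Y × U :=
  (p.2.1, p.2.2, γ.act (t + 1) (infoSucc t p.1 p.2.2))

lemma measurable_stage0 (γ : Policy Y U) : Measurable (stage0 (X := X) γ) :=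
  measurable_fst.prodMk (measurable_snd.prodMk
    ((γ.measurable_act 0).comp (measurable_info0.comp measurable_snd)))

lemma measurable_stageSucc (γ : Policy Y U) (t : ℕ) : Measurable (stageSucc (X := X) γ t) := by
  refine Measurable.prodMk (by fun_prop) (Measurable.prodMk (by fun_prop) ?_)
  exact (γ.measurable_act (t + 1)).comp ((measurable_infoSucc t).comp
    (measurable_fst.prodMk (measurable_snd.comp measurable_snd)))

/-- The last state and action of a history up to time `t`. -/
def lastStateAction (t : ℕ) (h : (i : Finset.Iic t) → X × Y × U) : X × U :=
  ((h ⟨t, Finset.mem_Iic.2 le_rfl⟩).1, (h ⟨t, Finset.mem_Iic.2 le_rfl⟩).2.2)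

lemma measurable_lastStateAction (t : ℕ) :
    Measurable (lastStateAction (X := X) (Y := Y) (U := U) t) := by
  unfold lastStateAction
  fun_prop

/-- The law of `(X_0, Y_0, U_0)`: `X_0 ∼ P`, `Y_0 ∼ Q(· | X_0)`, `U_0 = γ_0(Y_0)`. -/
def initialLaw (Q : Kernel X Y) (P : Measure X) (γ : Policy Y U) : Measure (X × Y × U) :=
  (P ⊗ₘ Q).map (stage0 γ)

/-- The conditional law of `(X_{t+1}, Y_{t+1}, U_{t+1})` given the past:
`X_{t+1} ∼ T(· | X_t, U_t)`, `Y_{t+1} ∼ Q(· | X_{t+1})`, `U_{t+1} = γ_{t+1}(I_{t+1})`. -/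
def stepKernel (T : Kernel (X × U) X) (Q : Kernel X Y) (γ : Policy Y U) (t : ℕ) :
    Kernel ((i : Finset.Iic t) → X × Y × U) (X × Y × U) :=
  (Kernel.id ×ₖ ((T.comap (lastStateAction t) (measurable_lastStateAction t)) ⊗ₖ
    (Q.comap Prod.snd measurable_snd))).map (stageSucc γ t)

instance isProbabilityMeasure_initialLaw (Q : Kernel X Y) [IsMarkovKernel Q] (P : Measure X)
    [IsProbabilityMeasure P] (γ : Policy Y U) : IsProbabilityMeasure (initialLaw Q P γ) :=
  Measure.isProbabilityMeasure_map (measurable_stage0 γ).aemeasurable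

instance isMarkovKernel_stepKernel (T : Kernel (X × U) X) [IsMarkovKernel T] (Q : Kernel X Y)
    [IsMarkovKernel Q] (γ : Policy Y U) (t : ℕ) : IsMarkovKernel (stepKernel T Q γ t) :=
  Kernel.IsMarkovKernel.map _ (measurable_stageSucc γ t)

/-- The law of the process `(X_t, Y_t, U_t)_{t ≥ 0}` under the prior `P` and the policy `γ`
(Ionescu-Tulcea). -/
def processLaw (T : Kernel (X × U) X) [IsMarkovKernel T] (Q : Kernel X Y) [IsMarkovKernel Q]
    (P : ProbabilityMeasure X) (γ : Policy Y U) : Measure (ℕ → X × Y × U) :=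
  Kernel.trajMeasure (X := fun _ => X × Y × U) (initialLaw Q (P : Measure X) γ)
    (stepKernel T Q γ)

/-- The discounted cost `J_β(P, T, γ) = E_P^γ [∑_t β^t c(X_t, U_t)]`. -/
def discountedCost (T : Kernel (X × U) X) [IsMarkovKernel T] (Q : Kernel X Y) [IsMarkovKernel Q]
    (c : X × U → ℝ) (β : ℝ) (P : ProbabilityMeasure X) (γ : Policy Y U) : ℝ :=
  ∫ ω, ∑' t : ℕ, β ^ t * c ((ω t).1, (ω t).2.2) ∂(processLaw T Q P γ)

/-- The optimal discounted cost `J_β*(P, T) = inf_γ J_β(P, T, γ)`. -/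
def optimalCost (T : Kernel (X × U) X) [IsMarkovKernel T] (Q : Kernel X Y) [IsMarkovKernel Q]
    (c : X × U → ℝ) (β : ℝ) (P : ProbabilityMeasure X) : ℝ :=
  ⨅ γ : Policy Y U, discountedCost T Q c β P γ

/-- The policy `γ` is optimal for the prior `P`. -/
def IsOptimal (T : Kernel (X × U) X) [IsMarkovKernel T] (Q : Kernel X Y) [IsMarkovKernel Q]
    (c : X × U → ℝ) (β : ℝ) (P : ProbabilityMeasure X) (γ : Policy Y U) : Prop :=
  ∀ γ' : Policy Y U, discountedCost T Q c β P γ ≤ discountedCost T Q c β P γ'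

end Model

end POMDP

end

/-! Everything reduces to one fact: J(Pn, γ) - J(P, γ) → 0 uniformly over policies γ
(`tendsto_discountedCost_sub`). Given it, an optimal policy for Pn does nearly as well under P as
any fixed competitor.

The expected cost at time n is the integral over the prior of a function of the initial state,
`expectedCost`, so uniformity follows once these functions are equicontinuous over all policies:
weak convergence is uniform on bounded equicontinuous families
(`eventually_forall_abs_integral_sub_lt`). Policies are only measurable, yet equicontinuity survives
each backward step. A weakly continuous `T` preserves it, compactness of `U` turns the action into a
mere index, and total variation continuity of `Q` lets observations be averaged out although the
integrand is arbitrary in y. The one-step disintegration of the trajectory measure identifies the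
recursion with the process, and dominated convergence sums over time. -/

noncomputable section

namespace POMDP

/-! ### Weak convergence and equicontinuous families -/

/-- An integral against a probability measure is close to a Riemann sum over finitely many pairwise
disjoint sets on which the integrand oscillates little. -/
lemma abs_integral_sub_sum_le {X : Type*} [MeasurableSpace X] (ν : Measure X)
    [IsProbabilityMeasure ν] {f : X → ℝ} (hf : Measurable f) {M ε : ℝ} (hM : ∀ x, |f x| ≤ M)
    (hε : 0 ≤ ε) {A : ℕ → Set X} (hA : ∀ k, MeasurableSet (A k))
    (hdisj : Pairwise (Function.onFun Disjoint A)) {p : ℕ → X}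
    (hosc : ∀ k, ∀ x ∈ A k, |f x - f (p k)| ≤ ε) (N : ℕ) :
    |∫ x, f x ∂ν - ∑ k ∈ Finset.range N, f (p k) * ν.real (A k)|
      ≤ ε + M * (1 - ∑ k ∈ Finset.range N, ν.real (A k)) := by
  have hind : ∀ k, Integrable ((A k).indicator fun _ => (1 : ℝ)) ν := fun k =>
    (integrable_const 1).indicator (hA k)
  have hint : ∀ k, ∫ x, (A k).indicator (fun _ => (1 : ℝ)) x ∂ν = ν.real (A k) := fun k => by
    rw [integral_indicator_const _ (hA k)]; simp
  have hfi : Integrable f ν :=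
    Integrable.of_bound hf.aestronglyMeasurable M (Eventually.of_forall hM)
  have hs : Integrable (fun x => ∑ k ∈ Finset.range N,
      f (p k) * (A k).indicator (fun _ => (1 : ℝ)) x) ν :=
    integrable_finsetSum _ fun k _ => (hind k).const_mul _
  have ht : Integrable (fun x => ∑ k ∈ Finset.range N,
      (A k).indicator (fun _ => (1 : ℝ)) x) ν :=
    integrable_finsetSum _ fun k _ => hind k
  have h1 : Integrable (fun x => 1 - ∑ k ∈ Finset.range N,
      (A k).indicator (fun _ => (1 : ℝ)) x) ν := (integrable_const _).sub ht
  have e1 : ∫ x, f x ∂ν - ∑ k ∈ Finset.range N, f (p k) * ν.real (A k) =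
      ∫ x, (f x - ∑ k ∈ Finset.range N, f (p k) * (A k).indicator (fun _ => (1 : ℝ)) x) ∂ν := by
    rw [integral_sub hfi hs, integral_finsetSum _ fun k _ => (hind k).const_mul _]
    simp only [integral_const_mul, hint]
  have e2 : ε + M * (1 - ∑ k ∈ Finset.range N, ν.real (A k)) =
      ∫ x, (ε + M * (1 - ∑ k ∈ Finset.range N, (A k).indicator (fun _ => (1 : ℝ)) x)) ∂ν := by
    rw [integral_add (integrable_const _) (h1.const_mul M), integral_const_mul,
      integral_sub (integrable_const _) ht,
      integral_finsetSum _ fun k _ => hind k]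
    simp only [hint]
    simp
  rw [e1, e2, ← Real.norm_eq_abs]
  have hb : Integrable (fun x => ε + M * (1 - ∑ k ∈ Finset.range N,
      (A k).indicator (fun _ => (1 : ℝ)) x)) ν := (integrable_const _).add (h1.const_mul M)
  refine norm_integral_le_of_norm_le hb (Eventually.of_forall fun x => ?_)
  rw [Real.norm_eq_abs]
  -- By disjointness exactly one indicator survives when x lies in one of the first N sets;
  -- otherwise both sums vanish and the crude bound M is used.
  by_cases hx : ∃ j < N, x ∈ A j
  · obtain ⟨j, hj, hxj⟩ := hx
    have hne : ∀ k ≠ j, x ∉ A k := fun k hk hxk =>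
      Set.disjoint_left.1 (hdisj hk) hxk hxj
    rw [Finset.sum_eq_single j (fun k _ hk => by simp [hne k hk])
        (fun h => absurd (Finset.mem_range.2 hj) h),
      Finset.sum_eq_single j (fun k _ hk => by simp [hne k hk])
        (fun h => absurd (Finset.mem_range.2 hj) h)]
    simpa [hxj] using hosc j x hxj
  · push Not at hx
    rw [Finset.sum_eq_zero fun k hk => by simp [hx k (Finset.mem_range.1 hk)],
      Finset.sum_eq_zero fun k hk => by simp [hx k (Finset.mem_range.1 hk)]]
    simpa using (hM x).trans (le_add_of_nonneg_left hε)

/-- A countable measurable partition into sets with null frontier on which an equicontinuous family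
oscillates little. -/
lemma exists_partition_of_equicontinuous {X ι : Type*} [TopologicalSpace X]
    [TopologicalSpace.MetrizableSpace X] [SecondCountableTopology X] [MeasurableSpace X]
    [BorelSpace X] (μ : Measure X) [IsProbabilityMeasure μ] {f : ι → X → ℝ}
    (hf : Equicontinuous f) {ε : ℝ} (hε : 0 < ε) :
    ∃ (A : ℕ → Set X) (p : ℕ → X), (∀ k, MeasurableSet (A k)) ∧
      Pairwise (Function.onFun Disjoint A) ∧ ⋃ k, A k = Set.univ ∧
      (∀ k, μ (frontier (A k)) = 0) ∧ ∀ k, ∀ x ∈ A k, ∀ i, |f i x - f i (p k)| ≤ ε := by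
  let _ := TopologicalSpace.metrizableSpaceMetric X
  have hB : ∀ x : X, ∃ r > 0, μ (frontier (Metric.ball x r)) = 0 ∧
      ∀ y ∈ Metric.ball x r, ∀ i, |f i y - f i x| ≤ ε := by
    intro x
    obtain ⟨δ, hδ, h⟩ := Metric.equicontinuousAt_iff.1 (hf x) ε hε
    -- The radius can be shrunk to one whose ball has null frontier, which the portmanteau theorem
    -- will require.
    obtain ⟨r, hr, hr0⟩ := exists_null_frontier_thickening μ {x} hδ
    rw [Metric.thickening_singleton] at hr0
    refine ⟨r, hr.1, hr0, fun y hy i => ?_⟩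
    have := h y ((Metric.mem_ball.1 hy).trans hr.2) i
    rw [dist_comm, Real.dist_eq] at this
    exact this.le
  choose r hr hfr hosc using hB
  obtain ⟨s, hs, hcov⟩ := TopologicalSpace.countable_cover_nhds
    fun x => Metric.ball_mem_nhds x (hr x)
  have hne : Nonempty X := nonempty_of_isProbabilityMeasure μ
  have hsne : s.Nonempty := by
    rw [Set.nonempty_iff_ne_empty]
    rintro rfl
    simp at hcov
    exact Set.empty_ne_univ hcov
  obtain ⟨p, rfl⟩ := hs.exists_eq_range hsne
  rw [Set.biUnion_range] at hcov
  refine ⟨disjointed fun k => Metric.ball (p k) (r (p k)), p,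
    fun k => MeasurableSet.disjointed (fun _ => measurableSet_ball) k,
    disjoint_disjointed _, by rw [iUnion_disjointed, hcov], fun k => ?_,
    fun k x hx => hosc _ _
      (disjointed_subset (fun k => Metric.ball (p k) (r (p k))) k hx)⟩
  -- Each set arises from a ball by removing finitely many balls, and the frontier of a difference
  -- lies in the union of the two frontiers.
  refine disjointedRec (f := fun k => Metric.ball (p k) (r (p k)))
    (p := fun t => μ (frontier t) = 0) (fun t i ht => ?_) (hfr (p k))
  refine measure_mono_null ?_ (measure_union_null ht (hfr (p i)))
  rw [Set.sdiff_eq]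
  refine (frontier_inter_subset _ _).trans (Set.union_subset_union Set.inter_subset_left ?_)
  rw [frontier_compl]
  exact Set.inter_subset_right

/-- Weak convergence is uniform over equicontinuous uniformly bounded families. -/
theorem eventually_forall_abs_integral_sub_lt {X ι κ : Type*} [TopologicalSpace X]
    [TopologicalSpace.MetrizableSpace X] [SecondCountableTopology X] [MeasurableSpace X]
    [BorelSpace X] {L : Filter κ} {μs : κ → ProbabilityMeasure X} {μ : ProbabilityMeasure X}
    (hμ : Tendsto μs L (𝓝 μ)) {f : ι → X → ℝ} (hf : Equicontinuous f) {M : ℝ}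
    (hM : ∀ i x, |f i x| ≤ M) {ε : ℝ} (hε : 0 < ε) :
    ∀ᶠ n in L, ∀ i, |∫ x, f i x ∂(μs n : Measure X) - ∫ x, f i x ∂(μ : Measure X)| < ε := by
  obtain ⟨A, p, hA, hdisj, hcov, hfr, hosc⟩ :=
    exists_partition_of_equicontinuous (μ : Measure X) hf (ε := ε / 4) (by positivity)
  have hlim : ∀ k, Tendsto (fun n => (μs n : Measure X).real (A k)) L
      (𝓝 ((μ : Measure X).real (A k))) := fun k =>
    (ENNReal.tendsto_toReal (measure_ne_top _ _)).comp
      (ProbabilityMeasure.tendsto_measure_of_null_frontier_of_tendsto' hμ (hfr k))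
  have hsum : Tendsto (fun N => ∑ k ∈ Finset.range N, (μ : Measure X).real (A k)) atTop
      (𝓝 1) := by
    have h := (ENNReal.hasSum_toReal (f := fun k => (μ : Measure X) (A k)) (by
      rw [← measure_iUnion hdisj hA]; exact measure_ne_top _ _)).tendsto_sum_nat
    rwa [← ENNReal.tsum_toReal_eq fun k => measure_ne_top _ _, ← measure_iUnion hdisj hA, hcov,
      ← measureReal_def, probReal_univ] at h
  -- Two Riemann-sum errors of ε/4 plus tails tend to ε/2, so some N brings them below ε. This N is
  -- fixed before n varies.
  have hN : Tendsto (fun N => ε / 4 + M * (1 - ∑ k ∈ Finset.range N, (μ : Measure X).real (A k))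
      + (ε / 4 + M * (1 - ∑ k ∈ Finset.range N, (μ : Measure X).real (A k)))) atTop
      (𝓝 (ε / 4 + M * (1 - 1) + (ε / 4 + M * (1 - 1)))) := by
    have := ((hsum.const_sub 1).const_mul M).const_add (ε / 4)
    exact this.add this
  obtain ⟨N, hN⟩ := (hN.eventually_lt_const (u := ε) (by linarith)).exists
  -- The bound involves only the masses of finitely many cells, not the index i; this is the source
  -- of uniformity.
  have hR : Tendsto (fun n => ε / 4 +
      M * (1 - ∑ k ∈ Finset.range N, (μs n : Measure X).real (A k))
      + (ε / 4 + M * (1 - ∑ k ∈ Finset.range N, (μ : Measure X).real (A k)))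
      + ∑ k ∈ Finset.range N, M * |(μs n : Measure X).real (A k) - (μ : Measure X).real (A k)|) L
      (𝓝 (ε / 4 + M * (1 - ∑ k ∈ Finset.range N, (μ : Measure X).real (A k))
      + (ε / 4 + M * (1 - ∑ k ∈ Finset.range N, (μ : Measure X).real (A k)))
      + ∑ k ∈ Finset.range N, M *
          |(μ : Measure X).real (A k) - (μ : Measure X).real (A k)|)) := by
    refine Tendsto.add (Tendsto.add_const _ (Tendsto.const_add _ (Tendsto.const_mul _
      (Tendsto.const_sub _ (tendsto_finsetSum _ fun k _ => hlim k))))) ?_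
    exact tendsto_finsetSum _ fun k _ => (((hlim k).sub_const _).abs).const_mul _
  filter_upwards [hR.eventually_lt_const (u := ε) (by simpa using hN)] with n hn i
  refine lt_of_le_of_lt ?_ hn
  have hfm : Measurable (f i) := (hf.continuous i).measurable
  have h1 := abs_integral_sub_sum_le (μs n : Measure X) hfm (hM i) (ε := ε / 4) (by positivity)
    hA hdisj (fun k x hx => hosc k x hx i) N
  have h2 := abs_integral_sub_sum_le (μ : Measure X) hfm (hM i) (ε := ε / 4) (by positivity)
    hA hdisj (fun k x hx => hosc k x hx i) N
  have h3 : |∑ k ∈ Finset.range N, f i (p k) * (μs n : Measure X).real (A k)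
      - ∑ k ∈ Finset.range N, f i (p k) * (μ : Measure X).real (A k)| ≤
      ∑ k ∈ Finset.range N,
        M * |(μs n : Measure X).real (A k) - (μ : Measure X).real (A k)| := by
    rw [← Finset.sum_sub_distrib]
    refine (Finset.abs_sum_le_sum_abs _ _).trans (Finset.sum_le_sum fun k _ => ?_)
    rw [← mul_sub, abs_mul]
    exact mul_le_mul_of_nonneg_right (hM _ _) (abs_nonneg _)
  rw [abs_le] at *
  constructor <;> linarith [h1.1, h1.2, h2.1, h2.2, h3.1, h3.2]

/-! ### Total variation and integrals of bounded functions -/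

lemma abs_measureReal_sub_le_tvDist {Y : Type*} [MeasurableSpace Y] (μ ν : Measure Y)
    [IsProbabilityMeasure μ] [IsProbabilityMeasure ν] {B : Set Y} (hB : MeasurableSet B) :
    |μ.real B - ν.real B| ≤ tvDist μ ν := by
  have hbdd : BddAbove (Set.range fun B : {B : Set Y // MeasurableSet B} =>
      |μ.real B.1 - ν.real B.1|) := by
    refine ⟨1, ?_⟩
    rintro _ ⟨B, rfl⟩
    rw [abs_le]
    constructor <;> linarith [measureReal_nonneg (μ := μ) (s := B.1),
      measureReal_nonneg (μ := ν) (s := B.1), measureReal_le_one (μ := μ) (s := B.1),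
      measureReal_le_one (μ := ν) (s := B.1)]
  have h := le_ciSup hbdd ⟨B, hB⟩
  have h0 := abs_nonneg (μ.real B - ν.real B)
  unfold tvDist
  dsimp only at h
  linarith

/-- The total variation distance controls the difference of integrals of bounded functions. -/
theorem abs_integral_sub_le_tvDist {Y : Type*} [MeasurableSpace Y] (μ ν : Measure Y)
    [IsProbabilityMeasure μ] [IsProbabilityMeasure ν] {f : Y → ℝ} (hf : Measurable f) {M : ℝ}
    (h0 : ∀ y, 0 ≤ f y) (hM : ∀ y, f y ≤ M) :
    |∫ y, f y ∂μ - ∫ y, f y ∂ν| ≤ M * tvDist μ ν := by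
  have hM0 : 0 ≤ M := by
    obtain ⟨y⟩ := nonempty_of_isProbabilityMeasure μ
    exact (h0 y).trans (hM y)
  -- Layer-cake formula: the integrals are compared through superlevel sets, over an interval of
  -- length M.
  have key : ∀ (ρ : Measure Y) [IsProbabilityMeasure ρ],
      ∫ y, f y ∂ρ = ∫ t in Set.Ioc 0 M, ρ.real {y | t ≤ f y} ∧
      IntegrableOn (fun t => ρ.real {y | t ≤ f y}) (Set.Ioc 0 M) := by
    intro ρ _
    have hi : Integrable f ρ := Integrable.of_bound hf.aestronglyMeasurable M
      (Eventually.of_forall fun y => by rw [Real.norm_eq_abs, abs_of_nonneg (h0 y)]; exact hM y)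
    refine ⟨hi.integral_eq_integral_Ioc_meas_le (Eventually.of_forall h0)
      (Eventually.of_forall hM), ?_⟩
    have hanti : Antitone fun t : ℝ => ρ.real {y | t ≤ f y} := fun s t hst =>
      measureReal_mono fun y (hy : t ≤ f y) => hst.trans hy
    exact ((hanti.antitoneOn (Set.Icc 0 M)).integrableOn_isCompact isCompact_Icc).mono_set
      Set.Ioc_subset_Icc_self
  rw [(key μ).1, (key ν).1, ← integral_sub (key μ).2 (key ν).2]
  have := norm_setIntegral_le_of_norm_le_const (μ := volume) (s := Set.Ioc 0 M)
    (f := fun t => μ.real {y | t ≤ f y} - ν.real {y | t ≤ f y}) (C := tvDist μ ν) (by simp)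
    (fun t _ => abs_measureReal_sub_le_tvDist μ ν (measurableSet_le measurable_const hf))
  rw [Real.norm_eq_abs, Real.volume_real_Ioc_of_le hM0, sub_zero, mul_comm] at this
  exact this

lemma integral_mem_Icc {A : Type*} [MeasurableSpace A] (μ : Measure A) [IsProbabilityMeasure μ]
    {f : A → ℝ} {M : ℝ} (hf : ∀ a, f a ∈ Set.Icc 0 M) : ∫ a, f a ∂μ ∈ Set.Icc 0 M := by
  refine ⟨integral_nonneg fun a => (hf a).1, ?_⟩
  have := norm_integral_le_of_norm_le_const (μ := μ) (f := f) (C := M)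
    (Eventually.of_forall fun a => by rw [Real.norm_eq_abs, abs_of_nonneg (hf a).1]; exact (hf a).2)
  rw [probReal_univ, mul_one] at this
  exact (le_abs_self _).trans this

lemma integrable_of_mem_Icc {A : Type*} [MeasurableSpace A] (μ : Measure A) [IsFiniteMeasure μ]
    {f : A → ℝ} (hf : Measurable f) {M : ℝ} (h : ∀ a, f a ∈ Set.Icc 0 M) : Integrable f μ :=
  Integrable.of_bound hf.aestronglyMeasurable M (Eventually.of_forall fun a => by
    rw [Real.norm_eq_abs, abs_of_nonneg (h a).1]; exact (h a).2)

/-! ### Operations preserving equicontinuity -/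

/-- A weakly continuous kernel maps equicontinuous uniformly bounded families to equicontinuous
families. -/
theorem WeaklyContinuous.equicontinuous_integral {A X ι : Type*} [TopologicalSpace A]
    [MeasurableSpace A] [TopologicalSpace X] [TopologicalSpace.MetrizableSpace X]
    [SecondCountableTopology X] [MeasurableSpace X] [BorelSpace X] {T : Kernel A X}
    [IsMarkovKernel T] (hT : WeaklyContinuous T) {f : ι → X → ℝ} (hf : Equicontinuous f) {M : ℝ}
    (hM : ∀ i x, f i x ∈ Set.Icc 0 M) : Equicontinuous fun i a => ∫ x, f i x ∂(T a) := by
  let τ : A → ProbabilityMeasure X := fun a => ⟨T a, inferInstance⟩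
  intro a
  have hτ : Tendsto τ (𝓝 a) (𝓝 (τ a)) :=
    ProbabilityMeasure.tendsto_iff_forall_integral_tendsto.2 fun g => (hT g).tendsto a
  rw [Metric.equicontinuousAt_iff_right]
  intro ε hε
  filter_upwards [eventually_forall_abs_integral_sub_lt hτ hf (M := M)
    (fun i x => by rw [abs_of_nonneg (hM i x).1]; exact (hM i x).2) hε] with b hb i
  rw [dist_comm, Real.dist_eq]
  exact hb i

/-- An equicontinuous family on `X × U` with `U` compact is equicontinuous in the first variable,
uniformly in the second one. -/
theorem equicontinuous_prodMk_of_compactSpace {X U ι : Type*} [TopologicalSpace X]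
    [TopologicalSpace U] [CompactSpace U] {ψ : ι → X × U → ℝ} (hψ : Equicontinuous ψ) :
    Equicontinuous fun (q : ι × U) x => ψ q.1 (x, q.2) := by
  intro x₀
  rw [Metric.equicontinuousAt_iff_right]
  intro ε hε
  -- Tube lemma. Near each u, both compared points are within ε/2 of the value at the centre (x₀,
  -- u).
  have := isCompact_univ.eventually_forall_of_forall_eventually (x₀ := x₀) (K := (Set.univ : Set U))
    (P := fun x u => ∀ i, dist (ψ i (x₀, u)) (ψ i (x, u)) < ε) fun u _ => by
      have h := Metric.equicontinuousAt_iff_right.1 (hψ (x₀, u)) (ε / 2) (by positivity)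
      have hc : Tendsto (fun z : X × U => (x₀, z.2)) (𝓝 (x₀, u)) (𝓝 (x₀, u)) := by
        have : Continuous fun z : X × U => (x₀, z.2) := by fun_prop
        simpa using this.tendsto (x₀, u)
      filter_upwards [h, hc.eventually h] with z h1 h2 i
      have := dist_triangle_left (ψ i (x₀, z.2)) (ψ i (z.1, z.2)) (ψ i (x₀, u))
      linarith [h1 i, h2 i]
  filter_upwards [this] with x hx q
  exact hx q.2 trivial q.1

/-- Averaging an equicontinuous family of functions of the state over the observation preserves
equicontinuity if the observation kernel is continuous in total variation. -/
theorem TVContinuous.equicontinuous_integral {X Y ι : Type*} [TopologicalSpace X]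
    [TopologicalSpace.MetrizableSpace X] [MeasurableSpace X] [MeasurableSpace Y] {Q : Kernel X Y}
    [IsMarkovKernel Q] (hQ : TVContinuous Q) {φ : ι → Y → X → ℝ}
    (hφ : Equicontinuous fun (q : ι × Y) x => φ q.1 q.2 x) {M : ℝ}
    (hM : ∀ i y x, φ i y x ∈ Set.Icc 0 M) (hmeas : ∀ i x, Measurable fun y => φ i y x) :
    Equicontinuous fun i x => ∫ y, φ i y x ∂(Q x) := by
  intro x₀
  rw [Metric.equicontinuousAt_iff_right]
  intro ε hε
  -- Metrizability makes 𝓝 x₀ countably generated, so the sequential hypothesis gives a limit along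
  -- the filter.
  have htv : Tendsto (fun x => M * tvDist (Q x) (Q x₀)) (𝓝 x₀) (𝓝 (M * 0)) :=
    (tendsto_of_seq_tendsto (f := fun x => tvDist (Q x) (Q x₀))
      fun xs hxs => hQ x₀ xs hxs).const_mul M
  rw [mul_zero] at htv
  filter_upwards [htv.eventually_lt_const (half_pos hε),
    Metric.equicontinuousAt_iff_right.1 (hφ x₀) (ε / 2) (half_pos hε)] with x h1 h2 i
  have hi : ∀ x x', Integrable (fun y => φ i y x) (Q x') := fun x x' =>
    integrable_of_mem_Icc _ (hmeas i x) fun y => hM i y x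
  -- The kernel moves with the integrand frozen at x₀; `h4` moves the integrand under the fixed
  -- measure `Q x`.
  have h3 := abs_integral_sub_le_tvDist (Q x) (Q x₀) (hmeas i x₀) (fun y => (hM i y x₀).1)
    fun y => (hM i y x₀).2
  have h4 : |∫ y, φ i y x ∂(Q x) - ∫ y, φ i y x₀ ∂(Q x)| ≤ ε / 2 := by
    rw [← integral_sub (hi _ _) (hi _ _)]
    have := norm_integral_le_of_norm_le_const (μ := Q x)
      (f := fun y => φ i y x - φ i y x₀) (C := ε / 2) (Eventually.of_forall fun y => by
        have := h2 (i, y)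
        rw [dist_comm, Real.dist_eq] at this
        exact this.le)
    simpa using this
  rw [dist_comm, Real.dist_eq]
  refine (abs_sub_le _ (∫ y, φ i y x₀ ∂(Q x)) _).trans_lt ?_
  linarith

/-! ### Conditional expected costs -/

/-- The observations and actions before time `k`. -/
abbrev Past (Y : Type*) (U : Type*) (k : ℕ) : Type _ := (Fin k → Y) × (Fin k → U)

/-- The information obtained from the past by adding the current observation. -/
def Past.observe {Y U : Type*} {k : ℕ} (j : Past Y U k) (y : Y) : Info Y U k :=
  (Fin.snoc (α := fun _ => Y) j.1 y, j.2)

/-- The past at time `k + 1`. -/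
def Past.extend {Y U : Type*} {k : ℕ} (j : Past Y U k) (y : Y) (u : U) : Past Y U (k + 1) :=
  (Fin.snoc (α := fun _ => Y) j.1 y, Fin.snoc (α := fun _ => U) j.2 u)

/-- The past at time `k` along a trajectory. -/
def pastOf {X Y U : Type*} (k : ℕ) (ω : ℕ → X × Y × U) : Past Y U k :=
  (fun i => (ω i).2.1, fun i => (ω i).2.2)

section

variable {X Y U : Type*}

lemma pastOf_succ (k : ℕ) (ω : ℕ → X × Y × U) :
    pastOf (k + 1) ω = (pastOf k ω).extend (ω k).2.1 (ω k).2.2 := by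
  unfold pastOf Past.extend
  refine Prod.ext (funext fun i => ?_) (funext fun i => ?_) <;>
    refine Fin.lastCases ?_ (fun i => ?_) i <;> simp

variable [MeasurableSpace X] [MeasurableSpace Y] [MeasurableSpace U]

lemma measurable_fin_snoc {A : Type*} [MeasurableSpace A] (k : ℕ) :
    Measurable fun p : (Fin k → A) × A => (Fin.snoc (α := fun _ => A) p.1 p.2 : Fin (k + 1) → A) := by
  refine measurable_pi_lambda _ fun i => Fin.lastCases ?_ (fun i => ?_) i
  · simpa using measurable_snd
  · simp only [Fin.snoc_castSucc]
    fun_prop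

lemma measurable_observe (k : ℕ) :
    Measurable fun p : Past Y U k × Y => Past.observe p.1 p.2 :=
  ((measurable_fin_snoc k).comp
    ((measurable_fst.comp measurable_fst).prodMk measurable_snd)).prodMk
    (measurable_snd.comp measurable_fst)

lemma measurable_extend (k : ℕ) :
    Measurable fun p : Past Y U k × Y × U => Past.extend p.1 p.2.1 p.2.2 :=
  ((measurable_fin_snoc k).comp ((measurable_fst.comp measurable_fst).prodMk
    (measurable_fst.comp measurable_snd))).prodMk
    ((measurable_fin_snoc k).comp ((measurable_snd.comp measurable_fst).prodMk
    (measurable_snd.comp measurable_snd)))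

/-- The action at time `k` given the past and the current observation. -/
def Policy.actPast (γ : Policy Y U) {k : ℕ} (j : Past Y U k) (y : Y) : U := γ.act k (j.observe y)

lemma Policy.measurable_actPast (γ : Policy Y U) (k : ℕ) :
    Measurable fun p : Past Y U k × Y => γ.actPast p.1 p.2 :=
  (γ.measurable_act k).comp (measurable_observe k)

/-- The expected cost at time `k + n` under `γ`, given the past at time `k` and the state at time
`k`. -/
def expectedCost (T : Kernel (X × U) X) (Q : Kernel X Y) (c : X × U → ℝ) (γ : Policy Y U) :
    (n k : ℕ) → Past Y U k → X → ℝ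
  | 0, _, j, x => ∫ y, c (x, γ.actPast j y) ∂(Q x)
  | n + 1, k, j, x => ∫ y, ∫ x', expectedCost T Q c γ n (k + 1) (j.extend y (γ.actPast j y)) x'
      ∂(T (x, γ.actPast j y)) ∂(Q x)

variable (T : Kernel (X × U) X) [IsMarkovKernel T] (Q : Kernel X Y) [IsMarkovKernel Q]
  {c : X × U → ℝ} {M : ℝ}

lemma expectedCost_mem_Icc (hc : ∀ p, c p ∈ Set.Icc 0 M) (γ : Policy Y U) (n : ℕ) :
    ∀ (k : ℕ) (j : Past Y U k) (x : X), expectedCost T Q c γ n k j x ∈ Set.Icc 0 M := by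
  induction n with
  | zero => exact fun k j x => integral_mem_Icc _ fun y => hc _
  | succ n ih => exact fun k j x => integral_mem_Icc _ fun y => integral_mem_Icc _ fun x' => ih _ _ _

lemma measurable_integral_obs {A : Type*} [MeasurableSpace A] {f : A → X → Y → ℝ}
    (hf : Measurable fun p : (A × X) × Y => f p.1.1 p.1.2 p.2) :
    Measurable fun p : A × X => ∫ y, f p.1 p.2 y ∂(Q p.2) :=
  (hf.stronglyMeasurable.integral_kernel_prod_right'
    (κ := Q.comap Prod.snd (measurable_snd (α := A)))).measurable

lemma measurable_integral_next {A : Type*} [MeasurableSpace A] {g : A → X × U} (hg : Measurable g)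
    {f : A → X → ℝ} (hf : Measurable fun p : A × X => f p.1 p.2) :
    Measurable fun a : A => ∫ x, f a x ∂(T (g a)) :=
  (hf.stronglyMeasurable.integral_kernel_prod_right' (κ := T.comap g hg)).measurable

lemma measurable_expectedCost (hc : Measurable c) (γ : Policy Y U) (n : ℕ) : ∀ k : ℕ,
    Measurable fun p : Past Y U k × X => expectedCost T Q c γ n k p.1 p.2 := by
  have hact : ∀ k, Measurable fun p : (Past Y U k × X) × Y => γ.actPast p.1.1 p.2 := fun k =>
    (γ.measurable_actPast k).comp ((measurable_fst.comp measurable_fst).prodMk measurable_snd)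
  induction n with
  | zero =>
    intro k
    exact measurable_integral_obs Q (f := fun j x y => c (x, γ.actPast j y))
      (hc.comp ((measurable_snd.comp measurable_fst).prodMk (hact k)))
  | succ n ih =>
    intro k
    refine measurable_integral_obs Q (f := fun j x y => ∫ x', expectedCost T Q c γ n (k + 1)
      (j.extend y (γ.actPast j y)) x' ∂(T (x, γ.actPast j y))) ?_
    refine measurable_integral_next T (g := fun p : (Past Y U k × X) × Y => (p.1.2, _))
      ((measurable_snd.comp measurable_fst).prodMk (hact k)) ?_
    refine (ih (k + 1)).comp (Measurable.prodMk ?_ measurable_snd)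
    exact ((measurable_extend k).comp ((measurable_fst.comp measurable_fst).prodMk
      (measurable_snd.prodMk (hact k)))).comp measurable_fst

/-- The expected costs are equicontinuous in the state, uniformly over all policies and pasts. -/
theorem equicontinuous_expectedCost [TopologicalSpace X] [TopologicalSpace.MetrizableSpace X]
    [SecondCountableTopology X] [BorelSpace X] [TopologicalSpace U] [CompactSpace U]
    (hT : WeaklyContinuous T) (hQ : TVContinuous Q) (hc : ∀ p, c p ∈ Set.Icc 0 M)
    (hc_cont : Continuous c) (hcm : Measurable c) (n : ℕ) :
    Equicontinuous fun (i : Σ k, Policy Y U × Past Y U k) x =>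
      expectedCost T Q c i.2.1 n i.1 i.2.2 x := by
  -- The time k belongs to the index, so the induction hypothesis also covers the extended pasts at
  -- time k + 1.
  induction n with
  | zero =>
    have h1 : Equicontinuous fun (_ : Unit) => c :=
      equicontinuous_unique.2 hc_cont
    have h2 := equicontinuous_prodMk_of_compactSpace h1
    refine hQ.equicontinuous_integral (M := M)
      (φ := fun (i : Σ k, Policy Y U × Past Y U k) y x => c (x, i.2.1.actPast i.2.2 y))
      (h2.comp fun q : (Σ k, Policy Y U × Past Y U k) × Y =>
        ((), q.1.2.1.actPast q.1.2.2 q.2)) (fun _ _ _ => hc _) fun i x => ?_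
    exact hcm.comp (measurable_const.prodMk
      ((i.2.1.measurable_actPast i.1).comp (measurable_const.prodMk measurable_id)))
  | succ n ih =>
    have h1 := hT.equicontinuous_integral ih (fun i x => expectedCost_mem_Icc T Q hc _ _ _ _ _)
    -- With the action as an index, any value depending on y may be substituted for it; no
    -- continuity of the policy enters.
    have h2 := equicontinuous_prodMk_of_compactSpace h1
    refine hQ.equicontinuous_integral (M := M)
      (φ := fun (i : Σ k, Policy Y U × Past Y U k) y x => ∫ x', expectedCost T Q c i.2.1 n (i.1 + 1)
        (i.2.2.extend y (i.2.1.actPast i.2.2 y)) x' ∂(T (x, i.2.1.actPast i.2.2 y)))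
      (h2.comp fun q : (Σ k, Policy Y U × Past Y U k) × Y => (⟨q.1.1 + 1, q.1.2.1,
        q.1.2.2.extend q.2 (q.1.2.1.actPast q.1.2.2 q.2)⟩, q.1.2.1.actPast q.1.2.2 q.2))
      (fun i y x => integral_mem_Icc _ fun x' => expectedCost_mem_Icc T Q hc _ _ _ _ _)
      fun i x => ?_
    have hact : Measurable fun y => i.2.1.actPast i.2.2 y :=
      (i.2.1.measurable_actPast i.1).comp (measurable_const.prodMk measurable_id)
    refine measurable_integral_next T (g := fun y => (x, i.2.1.actPast i.2.2 y))
      (measurable_const.prodMk hact) ?_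
    refine (measurable_expectedCost T Q hcm i.2.1 n (i.1 + 1)).comp
      (Measurable.prodMk ?_ measurable_snd)
    exact ((measurable_extend i.1).comp
      (measurable_const.prodMk (measurable_id.prodMk hact))).comp measurable_fst

end

/-! ### Disintegration of the process law -/

section

variable {X Y U : Type*} [MeasurableSpace X] [MeasurableSpace Y] [MeasurableSpace U]
  (T : Kernel (X × U) X) [IsMarkovKernel T] (Q : Kernel X Y) [IsMarkovKernel Q]
  {c : X × U → ℝ} {M : ℝ}

instance isProbabilityMeasure_processLaw (P : ProbabilityMeasure X) (γ : Policy Y U) :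
    IsProbabilityMeasure (processLaw T Q P γ) := by
  unfold processLaw
  infer_instance

lemma map_eval_zero_processLaw (P : ProbabilityMeasure X) (γ : Policy Y U) :
    (processLaw T Q P γ).map (fun ω => ω 0) = initialLaw Q (P : Measure X) γ := by
  have h : (fun ω : ℕ → X × Y × U => ω 0) =
      (fun h : (i : Finset.Iic 0) → X × Y × U => h ⟨0, Finset.mem_Iic.2 le_rfl⟩) ∘
        Preorder.frestrictLe (π := fun _ => X × Y × U) 0 := rfl
  rw [h, ← Measure.map_map (by fun_prop) (by fun_prop), processLaw, Kernel.trajMeasure,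
    Measure.map_comp _ _ (by fun_prop), Kernel.traj_map_frestrictLe, Kernel.partialTraj_self,
    Measure.id_comp, Measure.map_map (by fun_prop) (by fun_prop)]
  exact Measure.map_id

lemma integral_initialLaw (P : ProbabilityMeasure X) (γ : Policy Y U) {F : X × Y × U → ℝ}
    (hF : Measurable F) (hb : ∀ z, F z ∈ Set.Icc 0 M) :
    ∫ ω, F (ω 0) ∂(processLaw T Q P γ) =
      ∫ x, ∫ y, F (x, y, γ.actPast (Fin.elim0, Fin.elim0) y) ∂(Q x) ∂(P : Measure X) := by
  have h0 : ∀ y : Y, info0 U y = Past.observe (Fin.elim0, Fin.elim0) y := fun y =>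
    Prod.ext (funext fun i => by
      rw [Fin.fin_one_eq_zero i]
      exact (Fin.snoc_last (α := fun _ => Y) y Fin.elim0).symm) rfl
  have hm : Measurable fun p : X × Y => F (stage0 γ p) := hF.comp (measurable_stage0 γ)
  rw [← integral_map (φ := fun ω : ℕ → X × Y × U => ω 0) (f := F)
    (measurable_pi_apply 0).aemeasurable hF.aestronglyMeasurable, map_eval_zero_processLaw, initialLaw,
    integral_map (measurable_stage0 γ).aemeasurable hF.aestronglyMeasurable,
    Measure.integral_compProd (integrable_of_mem_Icc _ hm fun _ => hb _)]
  simp only [stage0, h0, Policy.actPast]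

lemma integral_stepKernel (γ : Policy Y U) (t : ℕ) (h : (i : Finset.Iic t) → X × Y × U)
    {F : X × Y × U → ℝ} (hF : Measurable F) (hb : ∀ z, F z ∈ Set.Icc 0 M) :
    ∫ z, F z ∂(stepKernel T Q γ t h) =
      ∫ x, ∫ y, F (x, y, γ.act (t + 1) (infoSucc t h y)) ∂(Q x) ∂(T (lastStateAction t h)) := by
  have hs : Measurable fun p => F (stageSucc γ t p) := hF.comp (measurable_stageSucc γ t)
  have hm : Measurable fun p : X × Y => F (stageSucc γ t (h, p)) :=
    hs.comp (measurable_const.prodMk measurable_id)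
  -- The factor `Kernel.id` contributes a Dirac mass at h, which only feeds the history to the
  -- policy.
  rw [stepKernel, Kernel.map_apply _ (measurable_stageSucc γ t),
    integral_map (measurable_stageSucc γ t).aemeasurable hF.aestronglyMeasurable,
    Kernel.prod_apply, Kernel.id_apply, integral_prod _ (integrable_of_mem_Icc _ hs fun _ => hb _),
    integral_dirac' _ _ hs.stronglyMeasurable.integral_prod_right',
    integral_compProd (integrable_of_mem_Icc _ hm fun _ => hb _)]
  rfl

/-- The one-step disintegration of the process law. -/
lemma integral_processLaw_succ (P : ProbabilityMeasure X) (γ : Policy Y U) (t : ℕ)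
    {F : Past Y U (t + 1) → X × Y × U → ℝ}
    (hF : Measurable fun p : Past Y U (t + 1) × X × Y × U => F p.1 p.2)
    (hb : ∀ j z, F j z ∈ Set.Icc 0 M) :
    ∫ ω, F (pastOf (t + 1) ω) (ω (t + 1)) ∂(processLaw T Q P γ) =
      ∫ ω, ∫ x, ∫ y, F (pastOf (t + 1) ω) (x, y, γ.actPast (pastOf (t + 1) ω) y) ∂(Q x)
        ∂(T ((ω t).1, (ω t).2.2)) ∂(processLaw T Q P γ) := by
  let hist : ((i : Finset.Iic t) → X × Y × U) → Past Y U (t + 1) := fun h =>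
    (fun i => (h ⟨i, Finset.mem_Iic.2 (Nat.lt_succ_iff.1 i.2)⟩).2.1,
      fun i => (h ⟨i, Finset.mem_Iic.2 (Nat.lt_succ_iff.1 i.2)⟩).2.2)
  have hhist : Measurable hist := by fun_prop
  have hG : Measurable fun p : ((i : Finset.Iic t) → X × Y × U) × X × Y × U =>
      F (hist p.1) p.2 := hF.comp ((hhist.comp measurable_fst).prodMk measurable_snd)
  have hdis := Kernel.map_frestrictLe_trajMeasure_compProd_eq_map_trajMeasure
    (X := fun _ => X × Y × U) (μ₀ := initialLaw Q (P : Measure X) γ)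
    (κ := stepKernel T Q γ) (a := t)
  have h1 : ∫ ω, F (pastOf (t + 1) ω) (ω (t + 1)) ∂(processLaw T Q P γ) =
      ∫ p, F (hist p.1) p.2 ∂((processLaw T Q P γ).map
        (fun ω => (Preorder.frestrictLe (π := fun _ => X × Y × U) t ω, ω (t + 1)))) := by
    rw [integral_map (by fun_prop) hG.aestronglyMeasurable]
    rfl
  have : IsProbabilityMeasure ((processLaw T Q P γ).map
      (Preorder.frestrictLe (π := fun _ => X × Y × U) t)) :=
    Measure.isProbabilityMeasure_map (by fun_prop)
  rw [h1, processLaw, ← hdis, ← processLaw, Measure.integral_compProd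
    (integrable_of_mem_Icc _ hG fun _ => hb _ _), integral_map (by fun_prop)
    (hG.stronglyMeasurable.integral_kernel_prod_right').aestronglyMeasurable]
  refine integral_congr_ae (Eventually.of_forall fun ω => ?_)
  exact integral_stepKernel T Q γ t _ (hG.comp (measurable_const.prodMk measurable_id))
    fun _ => hb _ _

/-- Induction on the remaining time n, for all k at once: the cost is viewed from time k + 2, and
disintegrating the stage at time k + 1 reproduces the recursion of `expectedCost`. -/
lemma integral_cost_succ (hcm : Measurable c) (hc : ∀ p, c p ∈ Set.Icc 0 M)
    (P : ProbabilityMeasure X) (γ : Policy Y U) (n : ℕ) : ∀ k,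
    ∫ ω, c ((ω (k + 1 + n)).1, (ω (k + 1 + n)).2.2) ∂(processLaw T Q P γ) =
      ∫ ω, ∫ x, expectedCost T Q c γ n (k + 1) (pastOf (k + 1) ω) x
        ∂(T ((ω k).1, (ω k).2.2)) ∂(processLaw T Q P γ) := by
  induction n with
  | zero =>
    intro k
    exact integral_processLaw_succ T Q P γ k (F := fun _ z => c (z.1, z.2.2)) (M := M)
      (hcm.comp (by fun_prop)) fun _ _ => hc _
  | succ n ih =>
    intro k
    have h := ih (k + 1)
    rw [show k + 1 + (n + 1) = k + 1 + 1 + n by ring, h]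
    simp only [pastOf_succ (k + 1)]
    refine integral_processLaw_succ T Q P γ k (M := M)
      (F := fun j z => ∫ x, expectedCost T Q c γ n (k + 1 + 1) (j.extend z.2.1 z.2.2) x
        ∂(T (z.1, z.2.2))) ?_ fun _ _ => integral_mem_Icc _ fun _ =>
          expectedCost_mem_Icc T Q hc _ _ _ _ _
    refine measurable_integral_next T (g := fun p : Past Y U (k + 1) × X × Y × U =>
      (p.2.1, p.2.2.2)) (by fun_prop) ?_
    exact (measurable_expectedCost T Q hcm γ n (k + 1 + 1)).comp
      (((measurable_extend (k + 1)).comp ((measurable_fst.comp measurable_fst).prodMk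
        (measurable_snd.comp (measurable_snd.comp measurable_fst)))).prodMk measurable_snd)

/-- The expected cost at time `n` as an integral over the prior. -/
theorem integral_cost_eq (hcm : Measurable c) (hc : ∀ p, c p ∈ Set.Icc 0 M)
    (P : ProbabilityMeasure X) (γ : Policy Y U) (n : ℕ) :
    ∫ ω, c ((ω n).1, (ω n).2.2) ∂(processLaw T Q P γ) =
      ∫ x, expectedCost T Q c γ n 0 (Fin.elim0, Fin.elim0) x ∂(P : Measure X) := by
  cases n with
  | zero =>
    exact integral_initialLaw T Q P γ (M := M) (F := fun z => c (z.1, z.2.2))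
      (hcm.comp (by fun_prop)) fun _ => hc _
  | succ n =>
    have h := integral_cost_succ T Q hcm hc P γ n 0
    rw [zero_add, add_comm 1 n] at h
    rw [h]
    have h0 : ∀ ω : ℕ → X × Y × U, pastOf 0 ω = (Fin.elim0, Fin.elim0) := fun ω =>
      Subsingleton.elim _ _
    simp only [pastOf_succ 0, h0]
    refine integral_initialLaw T Q P γ (M := M)
      (F := fun z => ∫ x, expectedCost T Q c γ n (0 + 1)
        (Past.extend (Fin.elim0, Fin.elim0) z.2.1 z.2.2) x ∂(T (z.1, z.2.2))) ?_
      fun _ => integral_mem_Icc _ fun _ => expectedCost_mem_Icc T Q hc _ _ _ _ _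
    refine measurable_integral_next T (g := fun z : X × Y × U => (z.1, z.2.2)) (by fun_prop) ?_
    exact (measurable_expectedCost T Q hcm γ n (0 + 1)).comp
      (((measurable_extend 0).comp (measurable_const.prodMk
        (measurable_snd.comp measurable_fst))).prodMk measurable_snd)

/-! ### Continuity of the discounted cost in the prior -/

/-- The discounted cost is the discounted sum of the expected costs. -/
theorem hasSum_discountedCost (hcm : Measurable c) (hc : ∀ p, c p ∈ Set.Icc 0 M) {β : ℝ}
    (hβ0 : 0 < β) (hβ1 : β < 1) (P : ProbabilityMeasure X) (γ : Policy Y U) :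
    HasSum (fun n => β ^ n * ∫ x, expectedCost T Q c γ n 0 (Fin.elim0, Fin.elim0) x
      ∂(P : Measure X)) (discountedCost T Q c β P γ) := by
  have hsum : Summable fun n => β ^ n * M := (summable_geometric_of_lt_one hβ0.le hβ1).mul_right M
  have hb : ∀ n p, ‖β ^ n * c p‖ ≤ β ^ n * M := fun n p => by
    rw [Real.norm_eq_abs, abs_of_nonneg (mul_nonneg (by positivity) (hc p).1)]
    exact mul_le_mul_of_nonneg_left (hc p).2 (by positivity)
  have h := hasSum_integral_of_dominated_convergence (μ := processLaw T Q P γ)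
    (F := fun n ω => β ^ n * c ((ω n).1, (ω n).2.2))
    (f := fun ω => ∑' n, β ^ n * c ((ω n).1, (ω n).2.2)) (fun n _ => β ^ n * M)
    (fun n => ((hcm.comp (by fun_prop)).const_mul _).aestronglyMeasurable)
    (fun n => Eventually.of_forall fun ω => hb n _) (Eventually.of_forall fun _ => hsum)
    (integrable_const _)
    (Eventually.of_forall fun ω => (Summable.of_norm_bounded hsum fun n => hb n _).hasSum)
  simp only [integral_const_mul, integral_cost_eq T Q hcm hc] at h
  exact h

/-- The discounted cost is continuous in the prior, uniformly over all policies. -/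
theorem tendsto_discountedCost_sub [TopologicalSpace X] [TopologicalSpace.MetrizableSpace X]
    [SecondCountableTopology X] [BorelSpace X] [TopologicalSpace U] [CompactSpace U]
    (hT : WeaklyContinuous T) (hQ : TVContinuous Q) (hc : ∀ p, c p ∈ Set.Icc 0 M)
    (hc_cont : Continuous c) (hcm : Measurable c) {β : ℝ} (hβ0 : 0 < β) (hβ1 : β < 1)
    {P : ProbabilityMeasure X} {Pn : ℕ → ProbabilityMeasure X} (hP : Tendsto Pn atTop (𝓝 P))
    (γ : ℕ → Policy Y U) :
    Tendsto (fun n => discountedCost T Q c β (Pn n) (γ n) - discountedCost T Q c β P (γ n))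
      atTop (𝓝 0) := by
  have hmem := expectedCost_mem_Icc T Q hc
  have hterm : ∀ k, Tendsto (fun n =>
      β ^ k * ∫ x, expectedCost T Q c (γ n) k 0 (Fin.elim0, Fin.elim0) x ∂(Pn n : Measure X)
      - β ^ k * ∫ x, expectedCost T Q c (γ n) k 0 (Fin.elim0, Fin.elim0) x ∂(P : Measure X))
      atTop (𝓝 0) := by
    intro k
    rw [← mul_zero (β ^ k)]
    simp only [← mul_sub]
    refine Tendsto.const_mul _ (Metric.tendsto_nhds.2 fun ε hε => ?_)
    filter_upwards [eventually_forall_abs_integral_sub_lt hP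
      (equicontinuous_expectedCost T Q hT hQ hc hc_cont hcm k) (M := M)
      (fun i x => by rw [abs_of_nonneg (hmem _ _ _ _ _).1]; exact (hmem _ _ _ _ _).2) hε] with n hn
    rw [Real.dist_eq, sub_zero]
    -- The estimate holds for all policies simultaneously, so the policy may vary with n.
    exact hn ⟨0, γ n, (Fin.elim0, Fin.elim0)⟩
  have h := tendsto_tsum_of_dominated_convergence (bound := fun k => β ^ k * M)
    ((summable_geometric_of_lt_one hβ0.le hβ1).mul_right M) hterm
    (Eventually.of_forall fun n k => by
      have h1 := integral_mem_Icc (Pn n : Measure X)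
        fun x => hmem (γ n) k 0 (Fin.elim0, Fin.elim0) x
      have h2 := integral_mem_Icc (P : Measure X) fun x => hmem (γ n) k 0 (Fin.elim0, Fin.elim0) x
      rw [← mul_sub, norm_mul, Real.norm_of_nonneg (by positivity), Real.norm_eq_abs]
      refine mul_le_mul_of_nonneg_left (abs_le.2 ⟨?_, ?_⟩) (by positivity) <;>
        linarith [h1.1, h1.2, h2.1, h2.2])
  rw [tsum_zero] at h
  refine h.congr fun n => ?_
  exact ((hasSum_discountedCost T Q hcm hc hβ0 hβ1 (Pn n) (γ n)).sub
    (hasSum_discountedCost T Q hcm hc hβ0 hβ1 P (γ n))).tsum_eq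

end

end POMDP

end

theorem mainTheorem2 {X : Type*} {Y : Type*} {U : Type*}
    [TopologicalSpace X] [TopologicalSpace.MetrizableSpace X] [SecondCountableTopology X]
    [MeasurableSpace X] [BorelSpace X] [StandardBorelSpace X]
    [MeasurableSpace Y] [StandardBorelSpace Y]
    [TopologicalSpace U] [TopologicalSpace.MetrizableSpace U] [CompactSpace U]
    [MeasurableSpace U] [BorelSpace U]
    (T : Kernel (X × U) X) [IsMarkovKernel T] (Q : Kernel X Y) [IsMarkovKernel Q]
    (c : X × U → ℝ) (β : ℝ) (hβ0 : 0 < β) (hβ1 : β < 1)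
    (hT : POMDP.WeaklyContinuous T) (hQ : POMDP.TVContinuous Q)
    (hc_nonneg : ∀ p, 0 ≤ c p) (hc_bdd : ∃ M : ℝ, ∀ p, c p ≤ M) (hc_cont : Continuous c)
    (P : ProbabilityMeasure X) (Pn : ℕ → ProbabilityMeasure X)
    (hP : Tendsto Pn atTop (𝓝 P))
    (γ : ℕ → POMDP.Policy Y U) (hγ : ∀ n, POMDP.IsOptimal T Q c β (Pn n) (γ n)) :
    Tendsto (fun n => POMDP.discountedCost T Q c β P (γ n)) atTop
      (𝓝 (POMDP.optimalCost T Q c β P)) := by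
  obtain ⟨M, hM⟩ := hc_bdd
  have hc : ∀ p, c p ∈ Set.Icc 0 M := fun p => ⟨hc_nonneg p, hM p⟩
  have hcm : Measurable c := by
    let _ := TopologicalSpace.metrizableSpaceMetric U
    exact hc_cont.measurable
  have hnonneg : ∀ γ', 0 ≤ POMDP.discountedCost T Q c β P γ' := fun γ' =>
    integral_nonneg fun ω => tsum_nonneg fun t => mul_nonneg (by positivity) (hc_nonneg _)
  have hbdd : BddBelow (Set.range fun γ' : POMDP.Policy Y U =>
      POMDP.discountedCost T Q c β P γ') := ⟨0, by rintro _ ⟨γ', rfl⟩; exact hnonneg γ'⟩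
  have hne : Nonempty (POMDP.Policy Y U) := ⟨γ 0⟩
  have hdiff := fun γ' : ℕ → POMDP.Policy Y U =>
    POMDP.tendsto_discountedCost_sub T Q hT hQ hc hc_cont hcm hβ0 hβ1 hP γ'
  refine tendsto_order.2 ⟨fun a ha => Eventually.of_forall fun n =>
    ha.trans_le (ciInf_le hbdd (γ n)), fun a ha => ?_⟩
  obtain ⟨γ', hγ'⟩ := exists_lt_of_ciInf_lt ha
  -- Both γ' and γ n are transferred between Pn and P, and optimality compares them under Pn. A
  -- policy γ' with cost below a suffices; no minimiser for P is needed.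
  have h := (hdiff fun _ => γ').sub (hdiff γ)
  rw [sub_zero] at h
  filter_upwards [h.eventually_lt_const (sub_pos.2 hγ')] with n hn
  linarith [hγ n γ']
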